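/- For an oriented link $L$ let $V_L(q)\in\mathbb Z[q,q^{-1}]$ be its Jones polynomial in the variable $q$, normalized by $V_{\mathrm{unknot}}=1$ and by the skein relation $$q^{-2}V_{L_+}(q)-q^{2}V_{L_-}(q)=(q^{-1}-q)\,V_{L_0}(q)$$ for oriented diagrams $L_+,L_-,L_0$ that differ only at one crossing, which is positive in $L_+$, negative in $L_-$, and replaced by its oriented smoothing in $L_0$. (It is computed from any oriented diagram with $n_+$ positive and $n_-$ negative crossings by the Kauffman state sum: $V=(-1)^{n_-}q^{n_+-2n_-}\sum_s(-q)^{|s|}(q+q^{-1})^{k(s)-1}$, where $s$ runs over the choices of a $0$- or $1$-smoothing at each crossing, $|s|$ is the number of $1$-smoothings in $s$, and $k(s)$ is the number of circles obtained.) Let $P(3,-2,2,-3)$ be the pretzel link: four vertical columns of $3,-2,2,-3$ half-twists side by side (the sign gives the handedness of the twists), where adjacent columns, and also the first and the last one, are joined by arcs at the top and at the bottom. For an integer $n$ let $KT_{2,n}$ be the Kinoshita–Terasaka knot obtained from this diagram as follows: the top arc that joins the two middle columns and the top arc that joins the first and the last column are replaced by one vertical column of $2|n|$ half-twists, whose lower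 ends are the inner top ends of the two middle columns and whose upper ends are joined to the outer top ends of the first and of the last column. In $KT_{2,n}$ the two strands of this column are antiparallel, and its crossings are positive if $n>0$ and negative if $n<0$. The link $P(3,-2,2,-3)$ carries the orientation obtained from that of $KT_{2,n}$ by the oriented smoothing of a crossing of this column. Write $V_n=V_{KT_{2,n}}$, $V=V_{P(3,-2,2,-3)}$ and $P_n=\sum_{k=1}^{n}\left(q^{4k-3}-q^{4k-1}\right)$. Then, for every positive integer $n$, $$V_n=q^{4n}+V\cdot P_n\qquad\text{and}\qquad V_{KT_{2,n}}'''(1)=576\,n\neq 0 ,$$ where the derivatives are taken with respect to $q$. -/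

import Mathlib

open scoped LaurentPolynomial

/-!
Oriented link diagrams are written as words of elementary horizontal slices (local minima, local
maxima and crossings), read from the bottom of the plane to the top. Positions are counted from
the left, starting with `0`.
-/

namespace KnotDiagram

/-- The vertical direction in which an oriented strand passes a horizontal level. -/
inductive Dir where
  | up
  | down
  deriving DecidableEq

/-- The opposite direction. -/
def Dir.rev : Dir → Dir
  | .up => .down
  | .down => .up

/-- The two kinds of unoriented crossing: the over-strand runs from bottom left to top right
(`rising`), or from bottom right to top left (`falling`). -/
inductive Over where
  | rising
  | falling
  deriving DecidableEq

/-- An elementary slice of an oriented link diagram.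
* `cup i d`: a local minimum creates two strands, at positions `i` and `i + 1`; the left one has
  direction `d` and the right one the opposite direction.
* `cap i`: a local maximum joins the strands at positions `i` and `i + 1`.
* `crossing i c`: the strands at positions `i` and `i + 1` cross. -/
inductive Slice where
  | cup (i : ℕ) (d : Dir)
  | cap (i : ℕ)
  | crossing (i : ℕ) (c : Over)

/-- The directions of the strands above a slice, given those below it (from left to right);
`none` if the slice does not fit. -/
def Slice.apply : Slice → List Dir → Option (List Dir)
  | .cup i d, l =>
      if i ≤ l.length then some (l.take i ++ d :: d.rev :: l.drop i) else none
  | .cap i, l =>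
      match l.drop i with
      | a :: b :: r => if a = b then none else some (l.take i ++ r)
      | _ => none
  | .crossing i _, l =>
      match l.drop i with
      | a :: b :: r => some (l.take i ++ b :: a :: r)
      | _ => none

/-- The directions of the strands above a word of slices. -/
def run : List Slice → List Dir → Option (List Dir)
  | [], l => some l
  | s :: w, l => (s.apply l).bind (run w)

/-- The sign of a crossing whose lower left end has direction `a` and whose lower right end has
direction `b`. If both strands go up (or both go down), the crossing is positive exactly when the
over-strand is rising; reversing one of the two strands changes the sign. -/
def crossingSign (c : Over) (a b : Dir) : ℤ :=
  match c with
  | .rising => if a = b then 1 else -1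
  | .falling => if a = b then -1 else 1

/-- The list of signs of the crossings of a slice (of length one or zero). -/
def Slice.signs : Slice → List Dir → List ℤ
  | .crossing i c, l =>
      match l.drop i with
      | a :: b :: _ => [crossingSign c a b]
      | _ => []
  | _, _ => []

/-- The list of signs of all crossings of a word. -/
def signs : List Slice → List Dir → List ℤ
  | [], _ => []
  | s :: w, l => s.signs l ++ (s.apply l).elim [] (signs w)

/-- A (non-empty) oriented link diagram: a word of slices that fit together, starting and ending
with no strands. -/
structure LinkDiagram where
  word : List Slice
  nonempty : word ≠ []
  closed : run word [] = some []

/-! ### The Jones polynomial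

A crossingless piece of diagram below a given level is recorded by the list of labels of its open
ends (two ends have the same label exactly when they bound the same arc) and by the number of its
closed loops. -/

/-- Labels of the open ends after a local minimum at position `i`; `f` is a fresh label. -/
def insertPair (f i : ℕ) (l : List ℕ) : List ℕ :=
  l.take i ++ f :: f :: l.drop i

/-- Labels of the open ends after a local maximum at positions `i`, `i + 1`, and the number of
loops (zero or one) that it closes. -/
def joinPair (i : ℕ) (l : List ℕ) : List ℕ × ℕ :=
  match l.drop i with
  | a :: b :: r =>
      if a = b then (l.take i ++ r, 1)
      else ((l.take i ++ r).map fun x => if x = b then a else x, 0)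
  | _ => (l, 0)

/-- The Kauffman state sum in the variable `q = T 1`: every crossing is replaced by its
`0`-smoothing minus `q` times its `1`-smoothing, and a crossingless diagram with `k` loops has the
value `(q + q⁻¹) ^ (k - 1)`. The `0`-smoothing joins the two regions swept out when the over-strand
is rotated counterclockwise towards the under-strand: for a `rising` crossing it consists of two
vertical strands and the `1`-smoothing is a local maximum below a local minimum; for a `falling`
crossing it is the other way round.

The arguments are the word that is still to be read, the labels of the open ends, the next fresh
label, and the number of loops closed so far. -/
noncomputable def bracket : List Slice → List ℕ → ℕ → ℕ → ℤ[T;T⁻¹]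
  | [], _, _, k => (LaurentPolynomial.T 1 + LaurentPolynomial.T (-1)) ^ (k - 1)
  | .cup i _ :: w, l, f, k => bracket w (insertPair f i l) (f + 1) k
  | .cap i :: w, l, f, k => bracket w (joinPair i l).1 f (k + (joinPair i l).2)
  | .crossing i .rising :: w, l, f, k =>
      bracket w l f k - LaurentPolynomial.T 1 *
        bracket w (insertPair f i (joinPair i l).1) (f + 1) (k + (joinPair i l).2)
  | .crossing i .falling :: w, l, f, k =>
      bracket w (insertPair f i (joinPair i l).1) (f + 1) (k + (joinPair i l).2) -
        LaurentPolynomial.T 1 * bracket w l f k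

/-- The Jones polynomial of a word: the state sum, multiplied by
`(-1) ^ n₋ * q ^ (n₊ - 2 n₋)`, where `n₊` and `n₋` are the numbers of positive and of negative
crossings. -/
noncomputable def jonesWord (w : List Slice) : ℤ[T;T⁻¹] :=
  (-1) ^ (signs w []).count (-1) *
    LaurentPolynomial.T (((signs w []).count 1 : ℤ) - 2 * ((signs w []).count (-1) : ℤ)) *
    bracket w [] 0 0

/-- The Jones polynomial `V(q)` of an oriented link diagram, normalized to be `1` on the unknot
and to satisfy `q⁻² V(L₊) - q² V(L₋) = (q⁻¹ - q) V(L₀)` (see `jones_unknot`, `jones_skein_parallel`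
and `jones_skein_antiparallel`). -/
noncomputable def LinkDiagram.jones (D : LinkDiagram) : ℤ[T;T⁻¹] :=
  jonesWord D.word

/-- The round diagram of the unknot. -/
def unknot : LinkDiagram where
  word := [.cup 0 .up, .cap 0]
  nonempty := by simp
  closed := by decide

theorem jones_unknot : unknot.jones = 1 := by
  simp [LinkDiagram.jones, unknot, jonesWord, signs, Slice.signs, Slice.apply, Dir.rev, bracket,
    insertPair, joinPair]

theorem run_append (u v : List Slice) (l : List Dir) :
    run (u ++ v) l = (run u l).bind (run v) := by
  induction u generalizing l with
  | nil => rfl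
  | cons s u ih =>
    simp only [List.cons_append, run]
    cases s.apply l with
    | none => rfl
    | some m => simp [ih]

theorem signs_append (u v : List Slice) (l m : List Dir) (h : run u l = some m) :
    signs (u ++ v) l = signs u l ++ signs v m := by
  induction u generalizing l with
  | nil => simp_all [run, signs]
  | cons s u ih =>
    simp only [run] at h
    simp only [List.cons_append, signs]
    cases hs : s.apply l with
    | none => simp [hs] at h
    | some m' =>
      simp only [hs, Option.bind_some] at h
      simp [ih m' h]

/-- The bracket depends linearly on what is put at a given place of a word. -/
theorem bracket_append_linear (x y z : List Slice) (α β γ : ℤ[T;T⁻¹])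
    (h : ∀ l f k, α * bracket x l f k + β * bracket y l f k = γ * bracket z l f k)
    (u : List Slice) (l : List ℕ) (f k : ℕ) :
    α * bracket (u ++ x) l f k + β * bracket (u ++ y) l f k = γ * bracket (u ++ z) l f k := by
  induction u generalizing l f k with
  | nil => exact h l f k
  | cons s u ih =>
    match s with
    | .cup i d => simpa [bracket] using ih _ _ _
    | .cap i => simpa [bracket] using ih _ _ _
    | .crossing i .rising =>
      simp only [List.cons_append, bracket]
      linear_combination ih l f k - LaurentPolynomial.T 1 *
        ih (insertPair f i (joinPair i l).1) (f + 1) (k + (joinPair i l).2)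
    | .crossing i .falling =>
      simp only [List.cons_append, bracket]
      linear_combination ih (insertPair f i (joinPair i l).1) (f + 1) (k + (joinPair i l).2) -
        LaurentPolynomial.T 1 * ih l f k

theorem jonesWord_skein (x y z u v : List Slice) (l l' : List Dir) (hl : run u [] = some l)
    (hx : signs (x ++ v) l = 1 :: signs v l') (hy : signs (y ++ v) l = -1 :: signs v l')
    (hz : signs (z ++ v) l = signs v l')
    (h : ∀ l f k, LaurentPolynomial.T (-1) * bracket (x ++ v) l f k + 1 * bracket (y ++ v) l f k =
      (LaurentPolynomial.T (-1) - LaurentPolynomial.T 1) * bracket (z ++ v) l f k) :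
    LaurentPolynomial.T (-2) * jonesWord (u ++ x ++ v) -
        LaurentPolynomial.T 2 * jonesWord (u ++ y ++ v) =
      (LaurentPolynomial.T (-1) - LaurentPolynomial.T 1) * jonesWord (u ++ z ++ v) := by
  have key := bracket_append_linear _ _ _ _ _ _ h u [] 0 0
  simp only [jonesWord, List.append_assoc, signs_append _ _ _ _ hl, hx, hy, hz,
    List.count_append, List.count_cons]
  norm_num
  generalize List.count (1 : ℤ) (signs u []) = p₁ at *
  generalize List.count (1 : ℤ) (signs v l') = p₂ at *
  generalize List.count (-1 : ℤ) (signs u []) = m₁ at *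
  generalize List.count (-1 : ℤ) (signs v l') = m₂ at *
  generalize bracket (u ++ (x ++ v)) [] 0 0 = X at *
  generalize bracket (u ++ (y ++ v)) [] 0 0 = Y at *
  generalize bracket (u ++ (z ++ v)) [] 0 0 = Z at *
  have e₁ : (LaurentPolynomial.T ((p₁ : ℤ) + (p₂ + 1) - 2 * (m₁ + m₂)) : ℤ[T;T⁻¹]) =
      LaurentPolynomial.T ((p₁ : ℤ) + p₂ - 2 * (m₁ + m₂)) * LaurentPolynomial.T 1 := by
    rw [← LaurentPolynomial.T_add]; congr 1; ring
  have e₂ : (LaurentPolynomial.T ((p₁ : ℤ) + p₂ - 2 * (m₁ + (m₂ + 1))) : ℤ[T;T⁻¹]) =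
      LaurentPolynomial.T ((p₁ : ℤ) + p₂ - 2 * (m₁ + m₂)) * LaurentPolynomial.T (-2) := by
    rw [← LaurentPolynomial.T_add]; congr 1; ring
  have e₃ : (LaurentPolynomial.T (-2) : ℤ[T;T⁻¹]) * LaurentPolynomial.T 1 =
      LaurentPolynomial.T (-1) := by
    rw [← LaurentPolynomial.T_add]; rfl
  have e₄ : (LaurentPolynomial.T 2 : ℤ[T;T⁻¹]) * LaurentPolynomial.T (-2) = 1 := by
    rw [← LaurentPolynomial.T_add]; rfl
  rw [e₁, e₂, pow_add, pow_add, pow_add, pow_one]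
  linear_combination (-1) ^ m₁ * (-1) ^ m₂ *
    LaurentPolynomial.T ((p₁ : ℤ) + p₂ - 2 * (m₁ + m₂)) * (key + X * e₃ + Y * e₄)

/-- The skein relation at a crossing of two strands that pass in the same vertical direction. -/
theorem jones_skein_parallel (u v : List Slice) (p r : List Dir) (a : Dir)
    (h : run u [] = some (p ++ a :: a :: r)) :
    LaurentPolynomial.T (-2) * jonesWord (u ++ [.crossing p.length .rising] ++ v) -
        LaurentPolynomial.T 2 * jonesWord (u ++ [.crossing p.length .falling] ++ v) =
      (LaurentPolynomial.T (-1) - LaurentPolynomial.T 1) * jonesWord (u ++ [] ++ v) := by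
  refine jonesWord_skein _ _ _ u v _ (p ++ a :: a :: r) h ?_ ?_ ?_ fun l f k => ?_
  · simp [signs, Slice.signs, Slice.apply, crossingSign]
  · simp [signs, Slice.signs, Slice.apply, crossingSign]
  · simp
  · have e : (LaurentPolynomial.T (-1) : ℤ[T;T⁻¹]) * LaurentPolynomial.T 1 = 1 := by
      rw [← LaurentPolynomial.T_add]; rfl
    simp only [List.cons_append, List.nil_append, bracket]
    linear_combination
      -bracket v (insertPair f p.length (joinPair p.length l).1) (f + 1)
        (k + (joinPair p.length l).2) * e

/-- The skein relation at a crossing of two strands that pass in opposite vertical directions. -/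
theorem jones_skein_antiparallel (u v : List Slice) (p r : List Dir) (a : Dir)
    (h : run u [] = some (p ++ a :: a.rev :: r)) :
    LaurentPolynomial.T (-2) * jonesWord (u ++ [.crossing p.length .falling] ++ v) -
        LaurentPolynomial.T 2 * jonesWord (u ++ [.crossing p.length .rising] ++ v) =
      (LaurentPolynomial.T (-1) - LaurentPolynomial.T 1) *
        jonesWord (u ++ [.cap p.length, .cup p.length a.rev] ++ v) := by
  refine jonesWord_skein _ _ _ u v _ (p ++ a.rev :: a :: r) h ?_ ?_ ?_ fun l f k => ?_
  · cases a <;> simp [signs, Slice.signs, Slice.apply, crossingSign, Dir.rev]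
  · cases a <;> simp [signs, Slice.signs, Slice.apply, crossingSign, Dir.rev]
  · cases a <;> simp [signs, Slice.signs, Slice.apply, Dir.rev]
  · have e : (LaurentPolynomial.T (-1) : ℤ[T;T⁻¹]) * LaurentPolynomial.T 1 = 1 := by
      rw [← LaurentPolynomial.T_add]; rfl
    simp only [List.cons_append, List.nil_append, bracket]
    linear_combination -bracket v l f k * e

/-- Evaluation of an integral Laurent polynomial at a real number `x ≠ 0`. -/
noncomputable def evalReal (V : ℤ[T;T⁻¹]) (x : ℝ) : ℝ :=
  V.coeff.sum fun k a => (a : ℝ) * x ^ k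

/-! ### Pretzel links and Kinoshita–Terasaka knots -/

/-- A vertical column of `|k|` half-twists of the strands at positions `i`, `i + 1`, all of one
handedness if `k > 0` and of the other handedness if `k < 0`. (With antiparallel strands, the
crossings are positive exactly when `k > 0`.) -/
def twist (i : ℕ) (k : ℤ) : List Slice :=
  List.replicate k.natAbs (.crossing i (if 0 < k then .falling else .rising))

/-- Four vertical columns of `a`, `b`, `c`, `d` half-twists side by side, closed at the bottom:
adjacent columns are joined by small minima, the first and the last one by a large minimum. The
directions `o₁` (of the large minimum), `o₂`, `o₃`, `o₄` are those of the left ends of the four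
minima. -/
def columns (a b c d : ℤ) (o₁ o₂ o₃ o₄ : Dir) : List Slice :=
  [.cup 0 o₁, .cup 1 o₂, .cup 3 o₃, .cup 5 o₄] ++
    twist 0 a ++ twist 2 b ++ twist 4 c ++ twist 6 d

/-- The standard diagram of the pretzel link `P(a, b, c, d)`: at the top, too, adjacent columns are
joined by small maxima, and the first and the last one by a large maximum. -/
def pretzelWord (a b c d : ℤ) (o₁ o₂ o₃ o₄ : Dir) : List Slice :=
  columns a b c d o₁ o₂ o₃ o₄ ++ [.cap 1, .cap 3, .cap 1, .cap 0]

/-- The standard diagram of the Kinoshita–Terasaka knot `KT_{r,n}`: in the diagram of the pretzel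
link `P(r + 1, -r, r, -(r + 1))`, the maximum that joins the two middle columns and the large
maximum above it are replaced by a vertical column of `2n` half-twists; its lower ends are the top
ends of the two middle columns, and its upper ends are joined to the first and to the last column. -/
def ktWord (r n : ℤ) (o₁ o₂ o₃ o₄ : Dir) : List Slice :=
  columns (r + 1) (-r) r (-(r + 1)) o₁ o₂ o₃ o₄ ++ [.cap 1, .cap 3] ++ twist 1 (2 * n) ++
    [.cap 0, .cap 0]

/-- The pretzel link `P(3, -2, 2, -3)`, with the orientation induced by the one of
`KinoshitaTerasaka`. -/
def pretzel : LinkDiagram where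
  word := pretzelWord 3 (-2) 2 (-3) .up .up .down .up
  nonempty := by simp [pretzelWord, columns]
  closed := by decide

theorem run_replicate (c : Over) (m : ℕ) (p r : List Dir) (a b : Dir) :
    run (List.replicate (2 * m) (.crossing p.length c)) (p ++ a :: b :: r) =
      some (p ++ a :: b :: r) := by
  induction m with
  | zero => rfl
  | succ m ih =>
    rw [show 2 * (m + 1) = 2 * m + 1 + 1 by ring]
    simp [List.replicate_succ, run, Slice.apply, ih]

/-- The Kinoshita–Terasaka knot `KT_{2,n}`, oriented. -/
def KinoshitaTerasaka (n : ℤ) : LinkDiagram where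
  word := ktWord 2 n .up .up .down .up
  nonempty := by simp [ktWord, columns]
  closed := by
    rw [ktWord, run_append, run_append]
    have h₁ : run (columns (2 + 1) (-2) 2 (-(2 + 1)) .up .up .down .up ++ [.cap 1, .cap 3]) [] =
        some ([.up] ++ .down :: .up :: [.down]) := by decide
    have h₂ := run_replicate (if 0 < 2 * n then .falling else .rising) n.natAbs
      [.up] [.down] .down .up
    rw [h₁, twist, Int.natAbs_mul]
    simp only [Option.bind_some]
    rw [show (2 : ℤ).natAbs = 2 from rfl]
    erw [h₂]
    decide

end KnotDiagram

open scoped LaurentPolynomial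

namespace KnotDiagram

open LaurentPolynomial

/-! Write `δ = q + q⁻¹`. Each crossing of the extra column is `e - q`, with `e` the turn-back and
`e² = δ e`. Since `(e - q) e = q⁻¹ e`, one gets `(e - q)^m = t_m e + (-q)^m`, where `t_m` is
`turnbackCoeff m` (`bracket_twist`). Closing `e` by the two upper maxima gives the pretzel link;
closing the identity gives the diagram with no extra twists, whose state sum is `-q^5`, that of an
unknot with five crossings of each sign. For `m = 2n` the normalization is `-q^(2n-5)`, so `V_n =
q^(2n) t_(2n) V + q^(4n)`, and `q^(2n) t_(2n) = P_n` (`T_mul_turnbackCoeff`).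

Only two state sums, of ten crossings each, have to be computed; this is done by the kernel on
integer lists. The third derivative follows from the explicit `V`: every step from `n` to `n + 1`
adds 576. -/

theorem T_one_mul_T_neg_one : (T 1 * T (-1) : ℤ[T;T⁻¹]) = 1 := by
  rw [← T_add]; rfl

/-! ### Computing state sums with lists of coefficients -/

/-- The polynomial in `T 1` with the given list of coefficients, the constant one first. -/
noncomputable def ofCoeffList : List ℤ → ℤ[T;T⁻¹]
  | [] => 0
  | a :: p => C a + T 1 * ofCoeffList p

/-- Coefficients of the difference of two polynomials. -/
def subCoeffList : List ℤ → List ℤ → List ℤ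
  | p, [] => p
  | [], b :: q => -b :: subCoeffList [] q
  | a :: p, b :: q => (a - b) :: subCoeffList p q

theorem ofCoeffList_sub (p q : List ℤ) :
    ofCoeffList (subCoeffList p q) = ofCoeffList p - ofCoeffList q := by
  induction p, q using subCoeffList.induct with
  | case1 p => cases p <;> simp [subCoeffList, ofCoeffList]
  | case2 b q ih => simp only [subCoeffList, ofCoeffList, ih, map_neg]; ring
  | case3 a p b q ih => simp only [subCoeffList, ofCoeffList, ih, map_sub]; ring

/-- Coefficients of `T N * (T 1 + T (-1)) ^ m`, for `m ≤ N`. -/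
def loopCoeffList : ℕ → ℕ → List ℤ
  | 0, _ => [1]
  | N + 1, 0 => 0 :: loopCoeffList N 0
  | N + 1, m + 1 =>
      subCoeffList (loopCoeffList N m) (0 :: 0 :: subCoeffList [] (loopCoeffList N m))

/-- Since `q δ = 1 + q²`, each factor `δ` absorbs one factor `q`. The sum `p + q² p` is coded as `p
- q² (0 - p)`, so that subtraction is the only list operation needed. -/
theorem ofCoeffList_loop (N m : ℕ) (h : m ≤ N) :
    ofCoeffList (loopCoeffList N m) = T N * (T 1 + T (-1)) ^ m := by
  induction N, m using loopCoeffList.induct with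
  | case1 m =>
    obtain rfl : m = 0 := by omega
    rw [loopCoeffList, ofCoeffList, ofCoeffList, Nat.cast_zero, T_zero, map_one, mul_zero,
      add_zero, pow_zero, mul_one]
  | case2 N ih =>
    simp only [loopCoeffList, ofCoeffList, ih (Nat.zero_le _)]
    push_cast
    rw [T_add, map_zero, zero_add, pow_zero, mul_one, mul_one, mul_comm]
  | case3 N m ih =>
    simp only [loopCoeffList, ofCoeffList, ofCoeffList_sub, ih (by omega)]
    push_cast
    rw [T_add, map_zero, pow_succ]
    linear_combination -(T (N : ℤ) * (T 1 + T (-1)) ^ m * T_one_mul_T_neg_one)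

/-- Coefficients of `T N * bracket w l f k`, for `N` large. -/
def bracketCoeffList (N : ℕ) : List Slice → List ℕ → ℕ → ℕ → List ℤ
  | [], _, _, k => loopCoeffList N (k - 1)
  | .cup i _ :: w, l, f, k => bracketCoeffList N w (insertPair f i l) (f + 1) k
  | .cap i :: w, l, f, k => bracketCoeffList N w (joinPair i l).1 f (k + (joinPair i l).2)
  | .crossing i .rising :: w, l, f, k =>
      subCoeffList (bracketCoeffList N w l f k)
        (0 :: bracketCoeffList N w (insertPair f i (joinPair i l).1) (f + 1)
          (k + (joinPair i l).2))
  | .crossing i .falling :: w, l, f, k =>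
      subCoeffList (bracketCoeffList N w (insertPair f i (joinPair i l).1) (f + 1)
        (k + (joinPair i l).2)) (0 :: bracketCoeffList N w l f k)

theorem joinPair_snd_le (i : ℕ) (l : List ℕ) : (joinPair i l).2 ≤ 1 := by
  unfold joinPair
  split
  · split <;> simp
  · simp

/-- A slice closes at most one loop, so the bound on `k + w.length` keeps the final exponent of `δ`
at most `N`, and `T N` clears all negative powers. -/
theorem ofCoeffList_bracket (N : ℕ) (w : List Slice) (l : List ℕ) (f k : ℕ)
    (h : k + w.length ≤ N) :
    ofCoeffList (bracketCoeffList N w l f k) = T N * bracket w l f k := by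
  induction w generalizing l f k with
  | nil => exact ofCoeffList_loop _ _ (by simp at h; omega)
  | cons s w ih =>
    rw [List.length_cons] at h
    match s with
    | .cup i d => exact ih _ _ _ (by omega)
    | .cap i =>
      have := joinPair_snd_le i l
      exact ih _ _ _ (by omega)
    | .crossing i .rising =>
      have := joinPair_snd_le i l
      simp only [bracketCoeffList, bracket, ofCoeffList_sub, ofCoeffList, map_zero]
      rw [ih _ _ _ (by omega), ih _ _ _ (by omega)]
      ring
    | .crossing i .falling =>
      have := joinPair_snd_le i l
      simp only [bracketCoeffList, bracket, ofCoeffList_sub, ofCoeffList, map_zero]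
      rw [ih _ _ _ (by omega), ih _ _ _ (by omega)]
      ring

/-! ### A column of half-twists under two nested maxima -/

/-- Whether `p` holds for the labels and the fresh label of each state of a word. -/
def allStates (p : List ℕ → ℕ → Bool) : List Slice → List ℕ → ℕ → Bool
  | [], l, f => p l f
  | .cup i _ :: w, l, f => allStates p w (insertPair f i l) (f + 1)
  | .cap i :: w, l, f => allStates p w (joinPair i l).1 f
  | .crossing i _ :: w, l, f =>
      allStates p w l f && allStates p w (insertPair f i (joinPair i l).1) (f + 1)

/-- A linear relation between brackets that holds for all states of `u` holds after `u`. -/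
theorem bracket_append_of_allStates (p : List ℕ → ℕ → Bool) (x y z : List Slice)
    (β γ : ℤ[T;T⁻¹])
    (h : ∀ l f k, p l f → bracket x l f k = β * bracket y l f k + γ * bracket z l f k)
    (u : List Slice) (l : List ℕ) (f k : ℕ) (hu : allStates p u l f) :
    bracket (u ++ x) l f k = β * bracket (u ++ y) l f k + γ * bracket (u ++ z) l f k := by
  induction u generalizing l f k with
  | nil => exact h l f k hu
  | cons s u ih =>
    match s with
    | .cup i d => simpa [bracket] using ih _ _ _ hu
    | .cap i => simpa [bracket] using ih _ _ _ hu
    | .crossing i .rising =>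
      simp only [allStates, Bool.and_eq_true] at hu
      simp only [List.cons_append, bracket]
      linear_combination ih l f k hu.1 - T 1 *
        ih (insertPair f i (joinPair i l).1) (f + 1) (k + (joinPair i l).2) hu.2
    | .crossing i .falling =>
      simp only [allStates, Bool.and_eq_true] at hu
      simp only [List.cons_append, bracket]
      linear_combination
        ih (insertPair f i (joinPair i l).1) (f + 1) (k + (joinPair i l).2) hu.2 -
          T 1 * ih l f k hu.1

/-- Whether `l` consists of the labels of the four ends of two disjoint arcs, all below `f`. -/
def isTwoArcs : List ℕ → ℕ → Bool
  | [a, b, c, d], f => (a = d ∧ b = c ∨ a = b ∧ c = d) ∧ a ≠ c ∧ a < f ∧ c < f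
  | _, _ => false

/-- The coefficient of the turn-back in the expansion of a column of `m` falling half-twists. -/
noncomputable def turnbackCoeff : ℕ → ℤ[T;T⁻¹]
  | 0 => 0
  | m + 1 => T (-1) * turnbackCoeff m + (-T 1) ^ m

/-- Apply `(e - q)^m = t_m e + (-q)^m` to `e`, on which `e` acts as `δ` and `e - q` as `q⁻¹`. -/
theorem turnbackCoeff_mul_loop (m : ℕ) :
    turnbackCoeff m * (T 1 + T (-1)) = T (-1) ^ m - (-T 1) ^ m := by
  induction m with
  | zero => simp [turnbackCoeff]
  | succ m ih =>
    rw [turnbackCoeff, pow_succ, pow_succ]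
    linear_combination T (-1) * ih

/-- The nested arcs are an eigenvector: the turn-back closes the inner arc to a loop and recreates
it under a fresh label, so each crossing contributes `δ - q = q⁻¹`. The maxima finally close one
more circle, which the exponent `k - 1` in `bracket` discounts. -/
theorem bracket_twist_nested (m : ℕ) {a c f : ℕ} (k : ℕ) (hac : a ≠ c) (haf : a < f) :
    bracket (List.replicate m (.crossing 1 .falling) ++ [.cap 0, .cap 0]) [a, c, c, a] f k =
      T (-1) ^ m * (T 1 + T (-1)) ^ k := by
  induction m generalizing c f k with
  | zero => simp [bracket, joinPair, hac]
  | succ m ih =>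
    have h₁ := ih (c := f) (f := f + 1) (k + 1) haf.ne (by omega)
    have h₂ := ih k hac haf
    simp only [List.replicate_succ, List.cons_append, bracket]
    rw [h₂]
    simp only [joinPair, insertPair, List.drop, List.take, if_true, List.cons_append,
      List.nil_append]
    rw [h₁]
    ring

/-- A turn-back merges the two arcs into the nested position, where the previous lemma applies; the
other smoothing leaves them unchanged, and at the end they close to two circles. -/
theorem bracket_twist_parallel (m : ℕ) {a c f : ℕ} (k : ℕ) (hac : a ≠ c) (haf : a < f) :
    bracket (List.replicate m (.crossing 1 .falling) ++ [.cap 0, .cap 0]) [a, a, c, c] f k =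
      turnbackCoeff m * (T 1 + T (-1)) ^ k + (-T 1) ^ m * (T 1 + T (-1)) ^ (k + 1) := by
  induction m with
  | zero => simp [bracket, joinPair, turnbackCoeff]
  | succ m ih =>
    have h₁ := bracket_twist_nested m (c := f) (f := f + 1) k haf.ne (by omega)
    simp only [List.replicate_succ, List.cons_append, bracket]
    rw [ih]
    simp only [joinPair, insertPair, List.take, List.cons_append,
      List.nil_append, List.map, if_neg hac, if_true, List.drop, add_zero]
    rw [h₁, turnbackCoeff]
    linear_combination -(T 1 + T (-1)) ^ k * turnbackCoeff_mul_loop m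

/-- Four ends bound only two planar pairings, nested or side by side, so the expansion is checked on
each. -/
theorem bracket_twist (m : ℕ) (l : List ℕ) (f k : ℕ) (h : isTwoArcs l f) :
    bracket (List.replicate m (.crossing 1 .falling) ++ [.cap 0, .cap 0]) l f k =
      turnbackCoeff m * bracket [.cap 1, .cap 0] l f k +
        (-T 1) ^ m * bracket [.cap 0, .cap 0] l f k := by
  match l with
  | [a, b, c, d] =>
    simp only [isTwoArcs, decide_eq_true_eq] at h
    obtain ⟨⟨rfl, rfl⟩ | ⟨rfl, rfl⟩, hac, haf, -⟩ := h
    · rw [bracket_twist_nested m k hac haf]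
      simp only [bracket, joinPair, List.drop, List.take, List.cons_append, List.nil_append,
        List.map, if_true, if_neg hac, add_zero, Nat.add_sub_cancel]
      linear_combination -(T 1 + T (-1)) ^ k * turnbackCoeff_mul_loop m
    · rw [bracket_twist_parallel m k hac haf]
      simp [bracket, joinPair, hac]
  | [] | [_] | [_, _] | [_, _, _] | _ :: _ :: _ :: _ :: _ :: _ => simp [isTwoArcs] at h

theorem T_mul_turnbackCoeff (n : ℕ) :
    T (2 * (n : ℤ)) * turnbackCoeff (2 * n) =
      ∑ k ∈ Finset.Icc 1 n, (T (4 * (k : ℤ) - 3) - T (4 * (k : ℤ) - 1)) := by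
  induction n with
  | zero => simp [turnbackCoeff]
  | succ n ih =>
    rw [Finset.sum_Icc_succ_top (by omega), ← ih, show 2 * (n + 1) = 2 * n + 1 + 1 by ring]
    simp only [turnbackCoeff, pow_succ, pow_mul, pow_zero, one_mul]
    have e₁ : ((-T 1 * -T 1) ^ n : ℤ[T;T⁻¹]) = T (2 * n) := by
      rw [neg_mul_neg, ← T_add, T_pow, mul_comm]; rfl
    have e₂ : (T (4 * ((n + 1 : ℕ) : ℤ) - 3) : ℤ[T;T⁻¹]) = T (2 * n) * T (2 * n) * T 1 := by
      rw [← T_add, ← T_add]; congr 1; push_cast; ring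
    have e₃ : (T (4 * ((n + 1 : ℕ) : ℤ) - 1) : ℤ[T;T⁻¹]) =
        T (2 * n) * T (2 * n) * (T 1 * T 1 * T 1) := by
      rw [← T_add, ← T_add, ← T_add, ← T_add]; congr 1; push_cast; ring
    have e₄ : (T (2 * ((n + 1 : ℕ) : ℤ)) : ℤ[T;T⁻¹]) = T (2 * n) * (T 1 * T 1) := by
      rw [← T_add, ← T_add]; congr 1
    rw [e₁, e₂, e₃, e₄]
    linear_combination (T (2 * (n : ℤ)) * turnbackCoeff (2 * n) * (T 1 * T (-1) + 1) +
      T (2 * n) * T (2 * n) * T 1) * T_one_mul_T_neg_one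

/-! ### The pretzel link and the Kinoshita–Terasaka knots -/

/-- The common part of the diagrams of `P(3, -2, 2, -3)` and of `KT_{2,n}`. -/
def ktBase : List Slice :=
  columns 3 (-2) 2 (-3) .up .up .down .up ++ [.cap 1, .cap 3]

theorem run_ktBase : run ktBase [] = some [.up, .down, .up, .down] := by decide

theorem count_one_signs_ktBase : (signs ktBase []).count 1 = 5 := by decide

theorem count_neg_one_signs_ktBase : (signs ktBase []).count (-1) = 5 := by decide

/-- A check of all `2^10` states, which lets `bracket_twist` be applied on top of `ktBase`. -/
theorem allStates_ktBase : allStates isTwoArcs ktBase [] 0 := by decide +kernel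

theorem T_mul_ofCoeffList_cons (m a : ℤ) (p : List ℤ) :
    T m * ofCoeffList (a :: p) = C a * T m + T (m + 1) * ofCoeffList p := by
  rw [ofCoeffList, T_add]
  ring

theorem T_mul_ofCoeffList_nil (m : ℤ) : T m * ofCoeffList [] = 0 := mul_zero _

theorem bracket_eq_of_bracketCoeffList (N : ℕ) {w : List Slice} {p : List ℤ}
    (hw : w.length ≤ N) (h : bracketCoeffList N w [] 0 0 = p) :
    bracket w [] 0 0 = T (-N) * ofCoeffList p := by
  rw [← h, ofCoeffList_bracket N w [] 0 0 (by omega), ← mul_assoc, ← T_add]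
  simp

theorem bracket_pretzel :
    bracket (ktBase ++ [.cap 1, .cap 0]) [] 0 0 = T (-4) *
      ofCoeffList [1, 0, -1, 0, 1, 0, -1, 0, -1, 0, -1, 0, -1, 0, 1, 0, -1, 0, 1] := by
  -- The word has 18 slices. The 14 leading zeros turn `T (-18)` into `T (-4)`.
  rw [bracket_eq_of_bracketCoeffList 18 (by decide)
    (p := [0, 0, 0, 0, 0, 0, 0, 0, 0, 0, 0, 0, 0, 0,
      1, 0, -1, 0, 1, 0, -1, 0, -1, 0, -1, 0, -1, 0, 1, 0, -1, 0, 1]) (by decide +kernel)]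
  simp only [T_mul_ofCoeffList_cons, T_mul_ofCoeffList_nil, map_zero, zero_mul, zero_add,
    Int.reduceAdd, Int.reduceNeg, Nat.cast_ofNat]

theorem bracket_ktBase : bracket (ktBase ++ [.cap 0, .cap 0]) [] 0 0 = -T 5 := by
  rw [bracket_eq_of_bracketCoeffList 18 (by decide)
    (p := [0, 0, 0, 0, 0, 0, 0, 0, 0, 0, 0, 0, 0, 0, 0, 0, 0, 0, 0, 0, 0, 0, 0,
      -1, 0, 0, 0, 0, 0, 0, 0, 0]) (by decide +kernel)]
  simp only [T_mul_ofCoeffList_cons, T_mul_ofCoeffList_nil, map_zero, map_neg, map_one, zero_mul,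
    neg_mul, one_mul, zero_add, add_zero, Int.reduceAdd, Int.reduceNeg, Nat.cast_ofNat]

theorem pretzel_jones_eq_bracket :
    pretzel.jones = -T (-5) * bracket (ktBase ++ [.cap 1, .cap 0]) [] 0 0 := by
  have hw : pretzel.word = ktBase ++ [.cap 1, .cap 0] := rfl
  have hs : signs [.cap 1, .cap 0] [.up, .down, .up, .down] = [] := rfl
  rw [LinkDiagram.jones, hw, jonesWord, signs_append _ _ _ _ run_ktBase, hs, List.append_nil,
    count_one_signs_ktBase, count_neg_one_signs_ktBase]
  norm_num

theorem pretzel_jones : pretzel.jones =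
    -T (-9) + T (-7) - T (-5) + T (-3) + T (-1) + T 1 + T 3 - T 5 + T 7 - T 9 := by
  rw [pretzel_jones_eq_bracket, bracket_pretzel, ← mul_assoc, neg_mul, ← T_add, neg_mul]
  simp only [T_mul_ofCoeffList_cons, T_mul_ofCoeffList_nil, map_zero, map_neg, map_one, zero_mul,
    neg_mul, one_mul, zero_add, add_zero, Int.reduceAdd, Int.reduceNeg]
  ring

/-- A crossing exchanges the two directions, so the induction removes two crossings at a time;
falling crossings of antiparallel strands are positive. -/
theorem signs_twist (m : ℕ) (v : List Slice) (p r : List Dir) (a : Dir) :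
    signs (List.replicate (2 * m) (.crossing p.length .falling) ++ v) (p ++ a :: a.rev :: r) =
      List.replicate (2 * m) 1 ++ signs v (p ++ a :: a.rev :: r) := by
  induction m with
  | zero => rfl
  | succ m ih =>
    rw [show 2 * (m + 1) = 2 * m + 1 + 1 by ring]
    have h : a ≠ a.rev := by cases a <;> decide
    simp [List.replicate_succ, signs, Slice.signs, Slice.apply, crossingSign, ih, h, h.symm]

theorem KinoshitaTerasaka_word (n : ℕ) (hn : 0 < n) : (KinoshitaTerasaka n).word =
    ktBase ++ (List.replicate (2 * n) (.crossing 1 .falling) ++ [.cap 0, .cap 0]) := by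
  have h : twist 1 (2 * (n : ℤ)) = List.replicate (2 * n) (.crossing 1 .falling) := by
    rw [twist, if_pos (by omega)]
    congr 1
  simp only [KinoshitaTerasaka, ktWord, h, ktBase, List.append_assoc]
  rfl

/-- The Jones polynomial of `KT_{2,n}` in terms of that of `P(3, -2, 2, -3)`. -/
theorem KinoshitaTerasaka_jones (n : ℕ) (hn : 0 < n) :
    (KinoshitaTerasaka n).jones = T (4 * (n : ℤ)) + pretzel.jones *
      ∑ k ∈ Finset.Icc 1 n, (T (4 * (k : ℤ) - 3) - T (4 * (k : ℤ) - 1)) := by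
  have hs := signs_twist n [.cap 0, .cap 0] [.up] [.down] .down
  have ht : signs [.cap 0, .cap 0] [.up, .down, .up, .down] = [] := rfl
  simp only [List.length_singleton, Dir.rev, List.singleton_append, ht, List.append_nil] at hs
  rw [LinkDiagram.jones, KinoshitaTerasaka_word n hn, jonesWord,
    signs_append _ _ _ _ run_ktBase, hs, List.count_append, List.count_append,
    count_one_signs_ktBase, count_neg_one_signs_ktBase, List.count_replicate_self,
    List.count_replicate, bracket_append_of_allStates isTwoArcs _ _ _ _ _
      (fun l f k h => bracket_twist (2 * n) l f k h) ktBase [] 0 0 allStates_ktBase,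
    bracket_ktBase, ← T_mul_turnbackCoeff, pretzel_jones_eq_bracket]
  have e₁ : ((-T 1) ^ (2 * n) : ℤ[T;T⁻¹]) = T (2 * n) := by
    rw [pow_mul, neg_sq, ← pow_mul, T_pow]; congr 1; push_cast; ring
  have e₂ : (T (((5 + 2 * n : ℕ) : ℤ) - 2 * ((5 : ℕ) : ℤ)) : ℤ[T;T⁻¹]) =
      T (2 * n) * T (-5) := by
    rw [← T_add]; congr 1; push_cast; ring
  have e₃ : (T (4 * (n : ℤ)) : ℤ[T;T⁻¹]) = T (2 * n) * T (2 * n) := by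
    rw [← T_add]; congr 1; ring
  have e₄ : (T (-5) * T 5 : ℤ[T;T⁻¹]) = 1 := by
    rw [← T_add]; rfl
  have e₅ : ((1 : ℤ) == -1) = false := rfl
  rw [e₁, e₃, e₅]
  simp only [Bool.false_eq_true, if_false, add_zero]
  rw [e₂]
  -- The factor `-q^(-5)` of the normalization cancels the state sum `-q^5` of the untwisted
  -- diagram.
  linear_combination T (2 * (n : ℤ)) * T (2 * n) * e₄

/-! ### The third derivative at `1` -/

/-- The third derivative at `1`, as a linear function of a Laurent polynomial. -/
noncomputable def thirdDerivAtOne : ℤ[T;T⁻¹] →+ ℝ where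
  toFun V := V.coeff.sum fun k a => (a : ℝ) * (k * (k - 1) * (k - 2))
  map_zero' := by simp
  map_add' V W := by
    rw [AddMonoidAlgebra.coeff_add]
    exact Finsupp.sum_add_index' (by simp) (by intros; push_cast; ring)

theorem thirdDerivAtOne_T (k : ℤ) : thirdDerivAtOne (T k) = k * (k - 1) * (k - 2) := by
  change ((Finsupp.single k 1).sum fun k (a : ℤ) => (a : ℝ) * (k * (k - 1) * (k - 2))) = _
  simp

theorem iteratedDeriv_three_evalReal (V : ℤ[T;T⁻¹]) :
    iteratedDeriv 3 (evalReal V) 1 = thirdDerivAtOne V := by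
  have hc (k : ℤ) : ContDiffAt ℝ 3 (fun x : ℝ => x ^ k) 1 := 
    (analyticAt_id.zpow one_ne_zero).contDiffAt
  change iteratedDeriv 3 (fun x => ∑ k ∈ V.coeff.support, (V.coeff k : ℝ) * x ^ k) 1 =
    ∑ k ∈ V.coeff.support, (V.coeff k : ℝ) * (k * (k - 1) * (k - 2))
  rw [iteratedDeriv_fun_sum fun k _ => contDiffAt_const.mul (hc k)]
  refine Finset.sum_congr rfl fun k _ => ?_
  rw [iteratedDeriv_const_mul _ (hc k), iteratedDeriv_eq_iterate, iter_deriv_zpow]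
  simp [Finset.prod_range_succ]

/-- The increment from `n` to `n + 1` is `q^(4n) F` with `F = V (q - q³) + q⁴ - 1`. As `V(1) = 2`
and `V'(1) = 0`, `F` vanishes to third order at `1`, so the factor `q^(4n)` has no effect, and
`F'''(1) = 12 - 6 V''(1) = 576` because `V''(1) = -94`. -/
theorem thirdDerivAtOne_pretzel_formula (n : ℕ) :
    thirdDerivAtOne (T (4 * (n : ℤ)) + pretzel.jones *
      ∑ k ∈ Finset.Icc 1 n, (T (4 * (k : ℤ) - 3) - T (4 * (k : ℤ) - 1))) = 576 * n := by
  induction n with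
  | zero =>
    rw [Finset.Icc_eq_empty (by omega), Finset.sum_empty, mul_zero, add_zero, thirdDerivAtOne_T]
    simp
  | succ n ih =>
    -- Explicitly, with `V` expanded, both sides are polynomials in `n`.
    have h : thirdDerivAtOne (pretzel.jones *
        (T (4 * ((n + 1 : ℕ) : ℤ) - 3) - T (4 * ((n + 1 : ℕ) : ℤ) - 1))) =
        576 + thirdDerivAtOne (T (4 * (n : ℤ))) -
          thirdDerivAtOne (T (4 * ((n + 1 : ℕ) : ℤ))) := by
      rw [pretzel_jones]
      simp only [add_mul, sub_mul, mul_sub, neg_mul, ← T_add, map_add, map_sub, map_neg,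
        thirdDerivAtOne_T]
      push_cast
      ring
    rw [Finset.sum_Icc_succ_top (by omega), mul_add, map_add, map_add, h]
    rw [map_add] at ih
    push_cast
    linear_combination ih

end KnotDiagram

theorem mainTheorem5 (n : ℕ) (hn : 0 < n) :
    (KnotDiagram.KinoshitaTerasaka n).jones =
        LaurentPolynomial.T (4 * (n : ℤ)) + KnotDiagram.pretzel.jones *
          ∑ k ∈ Finset.Icc 1 n,
            (LaurentPolynomial.T (4 * (k : ℤ) - 3) - LaurentPolynomial.T (4 * (k : ℤ) - 1)) ∧
      iteratedDeriv 3 (KnotDiagram.evalReal (KnotDiagram.KinoshitaTerasaka n).jones) 1 =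
        576 * (n : ℝ) ∧
      iteratedDeriv 3 (KnotDiagram.evalReal (KnotDiagram.KinoshitaTerasaka n).jones) 1 ≠ 0 := by
  have h := KnotDiagram.KinoshitaTerasaka_jones n hn
  have h₃ : iteratedDeriv 3
      (KnotDiagram.evalReal (KnotDiagram.KinoshitaTerasaka n).jones) 1 = 576 * (n : ℝ) := by
    rw [KnotDiagram.iteratedDeriv_three_evalReal, h,
      KnotDiagram.thirdDerivAtOne_pretzel_formula]
  refine ⟨h, h₃, ?_⟩
  rw [h₃]
  positivity
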